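/- Let $(X_1,\mu_1),\dots,(X_n,\mu_n)$ ($n\ge 1$) be $\sigma$-finite measure spaces with product $(X,\mu)$. For exponents $q_1,\dots,q_n\in(0,\infty]$ and a permutation $\sigma\in S_n$, the double $n$-tuple $$Q=\begin{pmatrix} q_1&\cdots&q_n\\ x_{\sigma(1)}&\cdots&x_{\sigma(n)}\end{pmatrix}$$ defines, for measurable $f:X\to[0,\infty]$, the mixed norm $\|f\|_Q$ obtained by taking first the $L^{q_1}(\mu_{\sigma(1)})$ norm in the variable $x_{\sigma(1)}$, then the $L^{q_2}(\mu_{\sigma(2)})$ norm in $x_{\sigma(2)}$, and so on, ending with the $L^{q_n}(\mu_{\sigma(n)})$ norm in $x_{\sigma(n)}$; that is, when all $q_j<\infty$, $$\|f\|_Q=\left(\int_{X_{\sigma(n)}}\cdots\left(\int_{X_{\sigma(1)}} f^{q_1}\,d\mu_{\sigma(1)}\right)^{q_2/q_1}\cdots\,d\mu_{\sigma(n)}\right)^{1/q_n},$$ with the essential supremum in the corresponding variable wherever $q_j=\infty$. (These need not be norms in the strict sense when some $q_j<1$.) Two double $n$-tuples with the same top row are identified if they differ only in the order of the variables within blocks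 of consecutive equal exponents. Let $p_1\ge p_2\ge\cdots\ge p_n$ be exponents in $(0,\infty]$, let $$\overline p=\left(\frac1n\sum_{j=1}^n p_j^{-1}\right)^{-1}$$ be their harmonic mean (with $\infty^{-1}=0$, $0^{-1}=\infty$), and for $\sigma\in S_n$ let $$P_\sigma=\begin{pmatrix} p_1&\cdots&p_n\\ x_{\sigma(1)}&\cdots&x_{\sigma(n)}\end{pmatrix}.$$ Let the orbit $\{P_\sigma:\sigma\in S_n\}$, modulo the above identification, be enumerated without repetition by $P_1,\dots,P_m$. Then for every measurable $f:X\to[0,\infty]$, $$\|f\|_{L^{\overline p}(X)}\le\prod_{i=1}^m\|f\|_{P_i}^{1/m}.$$ -/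

import Mathlib

open MeasureTheory
open scoped ENNReal

universe u

/-- The iterated norm of `f(x₁, …, xₙ)` with exponents `p₁, …, pₙ ∈ (0, ∞]`: first the `L^{p₁}` norm
in `x₁` (the innermost one), then the `L^{p₂}` norm in `x₂`, and so on, the `L^{pₙ}` norm in `xₙ`
being the outermost one. For `p = ∞`, `eLpNorm` is the essential supremum. -/
noncomputable def iteratedNorm : {n : ℕ} → {X : Fin n → Type u} →
    [(i : Fin n) → MeasurableSpace (X i)] → ((i : Fin n) → Measure (X i)) →
    (Fin n → ℝ≥0∞) → (((i : Fin n) → X i) → ℝ≥0∞) → ℝ≥0∞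
  | 0, _, _, _, _, f => f (fun i => i.elim0)
  | n + 1, X, _, μ, p, f =>
    eLpNorm
      (fun t : X (Fin.last n) =>
        iteratedNorm (X := fun i : Fin n => X i.castSucc) (fun i => μ i.castSucc)
          (fun i => p i.castSucc) (fun x => f (Fin.snoc x t)))
      (p (Fin.last n)) (μ (Fin.last n))

/-- A double `n`-tuple: the column in position `j` holds the exponent `exps j` and, below it, the
variable with index `vars j`. -/
structure DoubleTuple (n : ℕ) where
  exps : Fin n → ℝ≥0∞
  vars : Equiv.Perm (Fin n)

namespace DoubleTuple

variable {n : ℕ}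

/-- The double tuple with top row `p₁, …, pₙ` and bottom row `x₁, …, xₙ`. -/
def ofExponents (p : Fin n → ℝ≥0∞) : DoubleTuple n := ⟨p, 1⟩

/-- `P_σ`: the exponents keep their order, and the variable in position `j` becomes the one that
`P` has in position `σ j`. -/
def permVars (P : DoubleTuple n) (σ : Equiv.Perm (Fin n)) : DoubleTuple n := ⟨P.exps, P.vars * σ⟩

/-- The mixed norm `‖f‖_P`: the variables are taken in the order of the bottom row of `P`, from the
innermost to the outermost, with the exponents of the top row. The map `Equiv.piCongrLeft X P.vars`
sends `y`, listed in that order, to the point of `∏ i, X i` whose coordinate with index `P.vars j`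
is `y j`. -/
noncomputable def mixedNorm {X : Fin n → Type u} [(i : Fin n) → MeasurableSpace (X i)]
    (μ : (i : Fin n) → Measure (X i)) (P : DoubleTuple n) (f : ((i : Fin n) → X i) → ℝ≥0∞) :
    ℝ≥0∞ :=
  iteratedNorm (X := fun j => X (P.vars j)) (fun j => μ (P.vars j)) P.exps
    (fun y => f (Equiv.piCongrLeft X P.vars y))

/-- Two double tuples are identified if they differ only in the order of the variables within
blocks of consecutive equal exponents: the permutation `ρ` of the positions never moves a position
out of its block. -/
def Identified (P Q : DoubleTuple n) : Prop :=
  Q.exps = P.exps ∧ ∃ ρ : Equiv.Perm (Fin n), Q.vars = P.vars * ρ ∧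
    ∀ j, ∀ k ∈ Set.uIcc j (ρ j), P.exps k = P.exps j

/-- `Q₁, …, Qₘ` enumerate the orbit `{P_σ : σ ∈ Sₙ}` modulo the identification: they belong to the
orbit, no two of them are identified, and every member of the orbit is identified with one. -/
structure EnumeratesOrbit (P : DoubleTuple n) {m : ℕ} (Q : Fin m → DoubleTuple n) : Prop where
  mem_orbit : ∀ i, ∃ σ : Equiv.Perm (Fin n), Q i = P.permVars σ
  injective : ∀ i j, Identified (Q i) (Q j) → i = j
  surjective : ∀ σ : Equiv.Perm (Fin n), ∃ i, Identified (P.permVars σ) (Q i)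

end DoubleTuple

/-- The harmonic mean `(n⁻¹ ∑ j, pⱼ⁻¹)⁻¹` of exponents in `(0, ∞]`, with `∞⁻¹ = 0` and `0⁻¹ = ∞`. -/
noncomputable def harmonicMeanExponent {n : ℕ} (p : Fin n → ℝ≥0∞) : ℝ≥0∞ :=
  ((n : ℝ≥0∞)⁻¹ * ∑ j, (p j)⁻¹)⁻¹

/-! Write `f` as the product of `m` copies of `f ^ (1/m)`. Fix one order of the variables and, in
the `k`-th copy, let each variable keep the exponent that `P k` attaches to it. Hölder in one
variable after another (`listNorm_prod_rpow_le`) bounds the mixed norm with all exponents equal to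
the harmonic mean, hence the norm on the product (`eLpNorm_pi_le_listNorm`), by the geometric mean
of the `m` mixed norms in this fixed order. By Minkowski, moving larger exponents inside only
increases a mixed norm, and `P k` has them in decreasing order (`listNorm_le_mixedNorm`).

Hölder needs the reciprocal exponents at each variable to sum to `m` over the harmonic mean. This is
symmetry: transposing two variables permutes the classes of the orbit, so the sum is the same at
every variable (`sum_comp_symm_eq`), and averaging gives its value. -/

/-! ### Minkowski's inequality for two variables -/

section Minkowski

variable {α β : Type*} [MeasurableSpace α] [MeasurableSpace β]

theorem eLpNorm_ennreal_eq_lintegral {μ : Measure α} {p : ℝ≥0∞} (hp : p ≠ 0) (hp' : p ≠ ∞)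
    (f : α → ℝ≥0∞) : eLpNorm f p μ = (∫⁻ x, f x ^ p.toReal ∂μ) ^ (1 / p.toReal) := by
  simp [eLpNorm_eq_lintegral_rpow_enorm_toReal hp hp']

theorem eLpNorm_ennreal_mono_ae {μ : Measure α} {p : ℝ≥0∞} {f g : α → ℝ≥0∞}
    (h : ∀ᵐ x ∂μ, f x ≤ g x) : eLpNorm f p μ ≤ eLpNorm g p μ :=
  eLpNorm_mono_enorm_ae (by simpa using h)

theorem eLpNorm_ennreal_mono {μ : Measure α} {p : ℝ≥0∞} {f g : α → ℝ≥0∞}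
    (h : ∀ x, f x ≤ g x) : eLpNorm f p μ ≤ eLpNorm g p μ :=
  eLpNorm_ennreal_mono_ae (.of_forall h)

theorem eLpNorm_ennreal_top (μ : Measure α) (f : α → ℝ≥0∞) :
    eLpNorm f ∞ μ = essSup f μ := by
  simp [eLpNorm_exponent_top, eLpNormEssSup]

theorem Measurable.essSup_prod_right {ν : Measure β} [SFinite ν] {f : α → β → ℝ≥0∞}
    (hf : Measurable (Function.uncurry f)) : Measurable fun x => essSup (f x) ν := by
  refine measurable_of_Iic fun c => ?_
  have h : (fun x => essSup (f x) ν) ⁻¹' Set.Iic c =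
      {x | ν (Prod.mk x ⁻¹' {z | c < Function.uncurry f z}) = 0} := by
    ext x
    have : ν (Prod.mk x ⁻¹' {z | c < Function.uncurry f z}) = 0 ↔ ∀ᵐ y ∂ν, f x y ≤ c := by
      rw [ae_iff]
      simp [Set.preimage, Function.uncurry]
    simp only [Set.mem_preimage, Set.mem_Iic, Set.mem_ofPred_eq, this]
    refine ⟨fun h => (ENNReal.ae_le_essSup (f x)).mono fun y hy => hy.trans h,
      fun h => essSup_le_of_ae_le c h⟩
  rw [h]
  exact measurable_measure_prodMk_left (measurableSet_lt measurable_const hf)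
    (measurableSet_singleton 0)

theorem Measurable.eLpNorm_prod_right {ν : Measure β} [SFinite ν] {f : α → β → ℝ≥0∞}
    (hf : Measurable (Function.uncurry f)) (p : ℝ≥0∞) :
    Measurable fun x => eLpNorm (f x) p ν := by
  rcases eq_or_ne p 0 with rfl | hp
  · simp
  rcases eq_or_ne p ∞ with rfl | hp'
  · simpa only [eLpNorm_ennreal_top] using hf.essSup_prod_right
  simp only [eLpNorm_ennreal_eq_lintegral hp hp']
  exact ((hf.pow_const _).lintegral_prod_right).pow_const _

/-- Minkowski's integral inequality for a function that is truncated so as to have a finite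
integral. -/
theorem lintegral_rpow_rpow_le_of_le_lintegral {μ : Measure α} {ν : Measure β} [SFinite μ]
    [SFinite ν] {s : ℝ} (hs : 1 < s) {F : α → β → ℝ≥0∞} (hF : Measurable (Function.uncurry F))
    {G : α → ℝ≥0∞} (hG : Measurable G) (hGF : ∀ x, G x ≤ ∫⁻ y, F x y ∂ν)
    (hfin : ∫⁻ x, G x ^ s ∂μ ≠ ∞) :
    (∫⁻ x, G x ^ s ∂μ) ^ (1 / s) ≤ ∫⁻ y, (∫⁻ x, F x y ^ s ∂μ) ^ (1 / s) ∂ν := by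
  set A := ∫⁻ x, G x ^ s ∂μ with hA
  set B := ∫⁻ y, (∫⁻ x, F x y ^ s ∂μ) ^ (1 / s) ∂ν with hB
  have hs0 : 0 < s := by linarith
  rcases eq_or_ne A 0 with h0 | h0
  · rw [h0, ENNReal.zero_rpow_of_pos (by positivity)]
    exact zero_le
  have hconj : s.HolderConjugate (s / (s - 1)) := Real.HolderConjugate.conjExponent hs
  have hFx : ∀ y, Measurable fun x => F x y := fun y =>
    hF.comp (measurable_id.prodMk measurable_const)
  -- Split off one factor `G` from `G ^ s`, bound it by the integral of `F`, and apply Hölder in `x`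
  -- with exponents `s` and `s / (s - 1)`. The power of `A` can then be cancelled because `A` is
  -- neither `0` nor `∞`.
  have key : A ≤ B * A ^ (1 - 1 / s) := by
    calc A = ∫⁻ x, G x * G x ^ (s - 1) ∂μ := by
          refine lintegral_congr fun x => ?_
          conv_rhs => enter [1]; rw [← ENNReal.rpow_one (G x)]
          rw [← ENNReal.rpow_add_of_nonneg _ _ zero_le_one (by linarith)]
          congr 1; ring
      _ ≤ ∫⁻ x, (∫⁻ y, F x y ∂ν) * G x ^ (s - 1) ∂μ :=
          lintegral_mono fun x => mul_le_mul_left (hGF x) _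
      _ = ∫⁻ x, ∫⁻ y, F x y * G x ^ (s - 1) ∂ν ∂μ := by
          refine lintegral_congr fun x => ?_
          rw [lintegral_mul_const]
          exact hF.comp measurable_prodMk_left
      _ = ∫⁻ y, ∫⁻ x, F x y * G x ^ (s - 1) ∂μ ∂ν := by
          refine lintegral_lintegral_swap ?_
          exact (hF.mul ((hG.comp measurable_fst).pow_const _)).aemeasurable
      _ ≤ ∫⁻ y, (∫⁻ x, F x y ^ s ∂μ) ^ (1 / s) * A ^ (1 - 1 / s) ∂ν := by
          refine lintegral_mono fun y => ?_
          have := ENNReal.lintegral_mul_le_Lp_mul_Lq μ hconj (hFx y).aemeasurable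
            (hG.pow_const (s - 1)).aemeasurable
          refine this.trans (le_of_eq ?_)
          congr 1
          have e1 : (s - 1) * (s / (s - 1)) = s := by
            field_simp [(by linarith : s - 1 ≠ 0)]
          have e2 : 1 / (s / (s - 1)) = 1 - 1 / s := by
            field_simp
          simp_rw [← ENNReal.rpow_mul, e1, e2]
          rfl
      _ = B * A ^ (1 - 1 / s) := by
          refine lintegral_mul_const _ ?_
          exact (((hF.comp measurable_swap).pow_const s).lintegral_prod_right').pow_const _
  have hA1 : A ^ (1 - 1 / s) ≠ 0 := by
    simp [ENNReal.rpow_eq_zero_iff, h0, hfin]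
  have hA2 : A ^ (1 - 1 / s) ≠ ∞ := ENNReal.rpow_ne_top_of_ne_zero h0 hfin
  have : A ^ (1 / s) * A ^ (1 - 1 / s) = A := by
    rw [← ENNReal.rpow_add _ _ h0 hfin]; simp
  exact (ENNReal.mul_le_mul_iff_left hA1 hA2).1 (this.trans_le key)

/-- **Minkowski's integral inequality**. -/
theorem lintegral_lintegral_rpow_le {μ : Measure α} {ν : Measure β} [SigmaFinite μ]
    [SFinite ν] {s : ℝ} (hs : 1 ≤ s) {F : α → β → ℝ≥0∞} (hF : Measurable (Function.uncurry F)) :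
    (∫⁻ x, (∫⁻ y, F x y ∂ν) ^ s ∂μ) ^ (1 / s) ≤ ∫⁻ y, (∫⁻ x, F x y ^ s ∂μ) ^ (1 / s) ∂ν := by
  rcases hs.eq_or_lt with rfl | hs
  · simpa using (lintegral_lintegral_swap hF.aemeasurable).le
  have hs0 : 0 < s := by linarith
  set G : α → ℝ≥0∞ := fun x => ∫⁻ y, F x y ∂ν with hGdef
  have hG : Measurable G := hF.lintegral_prod_right
  set S := spanningSets μ
  -- Cutting off both the height and the support makes the integral of `H k ^ s` finite; monotone
  -- convergence then recovers `G`.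
  set H : ℕ → α → ℝ≥0∞ := fun k => (S k).indicator fun x => min (G x) k with hH
  have hHm : ∀ k, Measurable (H k) := fun k =>
    (hG.min measurable_const).indicator (measurableSet_spanningSets μ k)
  have hHG : ∀ k x, H k x ≤ G x := fun k x =>
    (Set.indicator_le_self' (fun _ _ => zero_le) x).trans (min_le_left _ _)
  have hmono : ∀ x, Monotone fun k => H k x := by
    intro x k l hkl
    refine Set.indicator_le_indicator_of_subset (monotone_spanningSets μ hkl)
      (fun _ => zero_le) x |>.trans ?_
    refine Set.indicator_le_indicator ?_
    exact min_le_min le_rfl (by exact_mod_cast hkl)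
  have hsup : ∀ x, ⨆ k, H k x = G x := by
    intro x
    refine le_antisymm (iSup_le fun k => hHG k x) (le_of_forall_lt fun c hc => ?_)
    obtain ⟨k, hk⟩ := ENNReal.exists_nat_gt (ne_top_of_lt hc)
    have hx := mem_spanningSetsIndex μ x
    have hmem : x ∈ S (max k (spanningSetsIndex μ x)) :=
      monotone_spanningSets μ (le_max_right _ _) hx
    refine lt_of_lt_of_le ?_ (le_iSup _ (max k (spanningSetsIndex μ x)))
    simp only [hH, Set.indicator_of_mem hmem]
    refine lt_min hc (hk.trans_le ?_)
    exact_mod_cast le_max_left _ _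
  have hbound : ∀ k, (∫⁻ x, H k x ^ s ∂μ) ^ (1 / s) ≤
      ∫⁻ y, (∫⁻ x, F x y ^ s ∂μ) ^ (1 / s) ∂ν := by
    intro k
    refine lintegral_rpow_rpow_le_of_le_lintegral hs hF (hHm k) (hHG k) ?_
    refine ne_top_of_le_ne_top (b := ∫⁻ x, (S k).indicator (fun _ => (k : ℝ≥0∞) ^ s) x ∂μ) ?_ ?_
    · rw [lintegral_indicator (measurableSet_spanningSets μ k), setLIntegral_const]
      exact ENNReal.mul_ne_top (ENNReal.rpow_ne_top_of_nonneg hs0.le (by simp))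
        (measure_spanningSets_lt_top μ k).ne
    · refine lintegral_mono fun x => ?_
      by_cases hx : x ∈ S k
      · simp only [hH, Set.indicator_of_mem hx]
        exact ENNReal.rpow_le_rpow (min_le_right _ _) hs0.le
      · simp [hH, Set.indicator_of_notMem hx, hs0]
  have hlim : ∫⁻ x, G x ^ s ∂μ = ⨆ k, ∫⁻ x, H k x ^ s ∂μ := by
    rw [← lintegral_iSup (fun k => (hHm k).pow_const s)]
    · refine lintegral_congr fun x => ?_
      rw [← hsup x]
      exact (ENNReal.orderIsoRpow s hs0).map_iSup _
    · intro k l hkl x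
      exact ENNReal.rpow_le_rpow (hmono x hkl) hs0.le
  rw [hlim, one_div, ENNReal.rpow_inv_le_iff hs0]
  refine iSup_le fun k => ?_
  rw [← ENNReal.rpow_inv_le_iff hs0, ← one_div]
  exact hbound k

/-- Minkowski's inequality for mixed norms: the norm is larger when the larger exponent is inside. -/
theorem eLpNorm_eLpNorm_le {μ : Measure α} {ν : Measure β} [SigmaFinite μ] [SigmaFinite ν]
    {p q : ℝ≥0∞} (hq : q ≠ 0) (hqp : q ≤ p) {f : α → β → ℝ≥0∞}
    (hf : Measurable (Function.uncurry f)) :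
    eLpNorm (fun x => eLpNorm (fun y => f x y) q ν) p μ ≤
      eLpNorm (fun y => eLpNorm (fun x => f x y) p μ) q ν := by
  have hf' : Measurable (Function.uncurry fun y x => f x y) := hf.comp measurable_swap
  rcases eq_or_ne p ∞ with rfl | hp
  · have hm := hf'.eLpNorm_prod_right (ν := μ) ∞
    -- For `p = ∞` it is enough to exchange the two almost-everywhere quantifiers.
    have h1 : ∀ᵐ y ∂ν, ∀ᵐ x ∂μ, f x y ≤ eLpNorm (fun x => f x y) ∞ μ := by
      refine .of_forall fun y => ?_
      rw [eLpNorm_ennreal_top]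
      exact ENNReal.ae_le_essSup _
    have h2 := (Measure.ae_ae_comm
      (p := fun x y => f x y ≤ eLpNorm (fun x => f x y) ∞ μ)
      (measurableSet_le hf (hm.comp measurable_snd))).2 h1
    rw [eLpNorm_ennreal_top]
    exact essSup_le_of_ae_le _ (h2.mono fun x hx => eLpNorm_ennreal_mono_ae hx)
  have hq' : q ≠ ∞ := ne_top_of_le_ne_top hp hqp
  have hp0 : p ≠ 0 := (hq.bot_lt.trans_le hqp).ne'
  have hqr : 0 < q.toReal := ENNReal.toReal_pos hq hq'
  have hpr : 0 < p.toReal := ENNReal.toReal_pos hp0 hp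
  simp only [eLpNorm_ennreal_eq_lintegral hq hq', eLpNorm_ennreal_eq_lintegral hp0 hp]
  have hs : 1 ≤ p.toReal / q.toReal :=
    (one_le_div hqr).2 (ENNReal.toReal_mono hp hqp)
  have := lintegral_lintegral_rpow_le (μ := μ) (ν := ν) hs
    (F := fun x y => f x y ^ q.toReal) (hf.pow_const q.toReal)
  have e1 : q.toReal * (p.toReal / q.toReal) = p.toReal := by field_simp
  have e2 : 1 / q.toReal * p.toReal = p.toReal / q.toReal := by field_simp
  have e3 : 1 / p.toReal * q.toReal = 1 / (p.toReal / q.toReal) := by field_simp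
  simp_rw [← ENNReal.rpow_mul, e1] at this
  simp_rw [← ENNReal.rpow_mul, e2, e3]
  have h4 := ENNReal.rpow_le_rpow this (by positivity : 0 ≤ 1 / q.toReal)
  rw [← ENNReal.rpow_mul] at h4
  convert h4 using 2
  field_simp

end Minkowski

/-! ### Hölder's inequality for several exponents -/

section Holder

variable {α ι : Type*} [MeasurableSpace α]

/-- Hölder's inequality for a geometric mean of `m` functions with exponents in `(0, ∞]`. -/
theorem eLpNorm_prod_rpow_le [Fintype ι] [Nonempty ι] {μ : Measure α} {q : ι → ℝ≥0∞} {r : ℝ≥0∞}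
    (hq : ∀ i, q i ≠ 0) (hr : ∑ i, (q i)⁻¹ = Fintype.card ι * r⁻¹) {g : ι → α → ℝ≥0∞}
    (hg : ∀ i, Measurable (g i)) :
    eLpNorm (fun x => ∏ i, g i x ^ (1 / (Fintype.card ι : ℝ))) r μ ≤
      ∏ i, eLpNorm (g i) (q i) μ ^ (1 / (Fintype.card ι : ℝ)) := by
  set m := Fintype.card ι
  have hm : 0 < m := Fintype.card_pos
  have hmr : (0 : ℝ) < m := by exact_mod_cast hm
  have hm0 : (m : ℝ≥0∞) ≠ 0 := by exact_mod_cast hm.ne'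
  have htop : ∀ i, q i = ∞ → ∀ᵐ x ∂μ, g i x ≤ eLpNorm (g i) (q i) μ := by
    intro i hi
    rw [hi, eLpNorm_ennreal_top]
    exact ENNReal.ae_le_essSup _
  rcases eq_or_ne r ∞ with rfl | hr'
  · have hqt : ∀ i, q i = ∞ := by simpa using hr
    rw [eLpNorm_ennreal_top]
    refine essSup_le_of_ae_le _ ?_
    filter_upwards [ae_all_iff.2 fun i => htop i (hqt i)] with x hx
    exact Finset.prod_le_prod' fun i _ => ENNReal.rpow_le_rpow (hx i) (by positivity)
  have hsum_ne : ∑ i, (q i)⁻¹ ≠ ∞ := by simp [hq]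
  have hr0 : r ≠ 0 := by
    rintro rfl
    rw [hr, ENNReal.inv_zero, ENNReal.mul_top hm0] at hsum_ne
    exact hsum_ne rfl
  have hrr : 0 < r.toReal := ENNReal.toReal_pos hr0 hr'
  set R := r.toReal
  -- Infinite exponents contribute `0` on both readings, since `∞.toReal = 0` and `0⁻¹ = 0` in `ℝ`.
  have hsum : ∑ i, ((q i).toReal)⁻¹ = m * R⁻¹ := by
    have := congrArg ENNReal.toReal hr
    rw [ENNReal.toReal_sum (by simp [hq])] at this
    simpa [ENNReal.toReal_inv] using this
  set w : ι → ℝ := fun i => R / m * ((q i).toReal)⁻¹ with hw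
  have hw1 : ∑ i, w i = 1 := by
    rw [← Finset.mul_sum, hsum]; field_simp
  have hw0 : ∀ i, 0 ≤ w i := fun i => by positivity
  -- Factors with infinite exponent have weight `w i = 0`; they are replaced by their essential
  -- bounds and taken out of the integral.
  set C : ι → ℝ≥0∞ := fun i => if q i = ∞ then eLpNorm (g i) (q i) μ ^ (R / m) else 1 with hC
  rw [eLpNorm_ennreal_eq_lintegral hr0 hr', one_div r.toReal, ENNReal.rpow_inv_le_iff hrr]
  have e0 : 1 / (m : ℝ) * R = R / m := by ring
  calc ∫⁻ x, (∏ i, g i x ^ (1 / (m : ℝ))) ^ R ∂μ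
      = ∫⁻ x, ∏ i, g i x ^ (R / m) ∂μ := by
        simp_rw [← ENNReal.prod_rpow_of_nonneg hrr.le, ← ENNReal.rpow_mul, e0]
    _ ≤ ∫⁻ x, (∏ i, C i) * ∏ i, (g i x ^ (q i).toReal) ^ w i ∂μ := by
        refine lintegral_mono_ae ?_
        filter_upwards [ae_all_iff.2 fun i => ae_all_iff.2 fun hi => htop i hi] with x hx
        rw [← Finset.prod_mul_distrib]
        refine Finset.prod_le_prod' fun i _ => ?_
        by_cases hi : q i = ∞
        · simp only [hC, hi, if_true, hw, ENNReal.toReal_top, ENNReal.rpow_zero, ENNReal.one_rpow,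
            mul_one]
          have := hx i hi
          rw [hi] at this
          exact ENNReal.rpow_le_rpow this (by positivity)
        · have hqi : 0 < (q i).toReal := ENNReal.toReal_pos (hq i) hi
          have : (q i).toReal * w i = R / m := by simp only [hw]; field_simp
          simp only [hC, hi, if_false, one_mul, ← ENNReal.rpow_mul, this, le_refl]
    _ = (∏ i, C i) * ∫⁻ x, ∏ i, (g i x ^ (q i).toReal) ^ w i ∂μ := by
        refine lintegral_const_mul _ ?_
        exact Finset.measurable_prod _ fun i _ => ((hg i).pow_const _).pow_const _
    _ ≤ (∏ i, C i) * ∏ i, (∫⁻ x, g i x ^ (q i).toReal ∂μ) ^ w i := by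
        gcongr
        exact ENNReal.lintegral_prod_norm_pow_le _
          (fun i _ => ((hg i).pow_const _).aemeasurable) hw1 fun i _ => hw0 i
    _ = (∏ i, eLpNorm (g i) (q i) μ ^ (1 / (m : ℝ))) ^ R := by
        rw [← ENNReal.prod_rpow_of_nonneg hrr.le, ← Finset.prod_mul_distrib]
        refine Finset.prod_congr rfl fun i _ => ?_
        rw [← ENNReal.rpow_mul, e0]
        by_cases hi : q i = ∞
        · simp [hC, hi, hw]
        · have hqi : 0 < (q i).toReal := ENNReal.toReal_pos (hq i) hi
          rw [eLpNorm_ennreal_eq_lintegral (hq i) hi, ← ENNReal.rpow_mul]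
          simp only [hC, hi, if_false, one_mul, hw]
          congr 1
          ring

end Holder

/-! ### Mixed norms along a list of variables -/

section MixedNorms

variable {ι : Type*} [DecidableEq ι] {X : ι → Type*} [∀ i, MeasurableSpace (X i)]
  (μ : ∀ i, Measure (X i))

/-- The `L^p` norm of `g` in the variable `x i`, as a function of the remaining variables. -/
noncomputable def partialNorm (i : ι) (p : ℝ≥0∞) (g : (∀ i, X i) → ℝ≥0∞) (x : ∀ i, X i) : ℝ≥0∞ :=
  eLpNorm (fun t => g (Function.update x i t)) p (μ i)

/-- The mixed norm of `g` along a list of variables with exponents, the head of the list being the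
innermost one. -/
noncomputable def listNorm : List (ι × ℝ≥0∞) → ((∀ i, X i) → ℝ≥0∞) → (∀ i, X i) → ℝ≥0∞
  | [], g => g
  | a :: l, g => listNorm l (partialNorm μ a.1 a.2 g)

@[simp] theorem listNorm_nil (g : (∀ i, X i) → ℝ≥0∞) : listNorm μ [] g = g := rfl

@[simp] theorem listNorm_cons (a : ι × ℝ≥0∞) (l : List (ι × ℝ≥0∞)) (g : (∀ i, X i) → ℝ≥0∞) :
    listNorm μ (a :: l) g = listNorm μ l (partialNorm μ a.1 a.2 g) := rfl

theorem listNorm_append (l l' : List (ι × ℝ≥0∞)) (g : (∀ i, X i) → ℝ≥0∞) :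
    listNorm μ (l ++ l') g = listNorm μ l' (listNorm μ l g) := by
  induction l generalizing g with
  | nil => rfl
  | cons a l ih => simp [ih]

theorem partialNorm_mono (i : ι) (p : ℝ≥0∞) {g h : (∀ i, X i) → ℝ≥0∞} (hgh : g ≤ h) :
    partialNorm μ i p g ≤ partialNorm μ i p h :=
  fun _ => eLpNorm_ennreal_mono fun _ => hgh _

theorem listNorm_mono (l : List (ι × ℝ≥0∞)) {g h : (∀ i, X i) → ℝ≥0∞} (hgh : g ≤ h) :
    listNorm μ l g ≤ listNorm μ l h := by
  induction l generalizing g h with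
  | nil => exact hgh
  | cons a l ih => exact ih (partialNorm_mono μ _ _ hgh)

/-- Each partial norm removes the dependence on its variable. When the list exhausts the variables,
the base point is thus immaterial. -/
theorem listNorm_congr_of_eq_off (l : List (ι × ℝ≥0∞)) (g : (∀ i, X i) → ℝ≥0∞) (s : Set ι)
    (hg : ∀ x y, (∀ i ∈ s, x i = y i) → g x = g y) {x y : ∀ i, X i}
    (h : ∀ i ∈ s, (∀ a ∈ l, a.1 ≠ i) → x i = y i) : listNorm μ l g x = listNorm μ l g y := by
  induction l generalizing g s with
  | nil => exact hg _ _ fun i hi => h i hi (by simp)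
  | cons a l ih =>
    refine ih (partialNorm μ a.1 a.2 g) (s \ {a.1}) (fun x y hxy => ?_) fun i hi hl => ?_
    · refine congrArg (fun F => eLpNorm F a.2 (μ a.1)) (funext fun t => hg _ _ fun i hi => ?_)
      rcases eq_or_ne i a.1 with rfl | hne
      · simp
      · simp [hne, hxy i ⟨hi, hne⟩]
    · exact h i hi.1 (List.forall_mem_cons.2 ⟨fun e => hi.2 e.symm, hl⟩)

variable [∀ i, SigmaFinite (μ i)]

theorem Measurable.partialNorm {g : (∀ i, X i) → ℝ≥0∞} (hg : Measurable g) (i : ι) (p : ℝ≥0∞) :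
    Measurable (partialNorm μ i p g) :=
  Measurable.eLpNorm_prod_right (f := fun x t => g (Function.update x i t))
    (hg.comp measurable_update') p

theorem partialNorm_partialNorm_le {g : (∀ i, X i) → ℝ≥0∞} (hg : Measurable g) {i j : ι}
    (hij : i ≠ j) {p q : ℝ≥0∞} (hq : q ≠ 0) (hqp : q ≤ p) :
    partialNorm μ i p (partialNorm μ j q g) ≤ partialNorm μ j q (partialNorm μ i p g) := by
  intro x
  have hm : Measurable (Function.uncurry fun s t =>
      g (Function.update (Function.update x i s) j t)) := by
    refine hg.comp (measurable_update'.comp (Measurable.prodMk ?_ measurable_snd))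
    exact (measurable_update x).comp measurable_fst
  have := eLpNorm_eLpNorm_le (μ := μ i) (ν := μ j) hq hqp hm
  simp only [partialNorm, Function.update_comm hij.symm]
  simpa only [partialNorm, Function.update_comm hij] using this

/-- Moving a variable that carries the largest exponent to the innermost position increases the
mixed norm. -/
theorem listNorm_append_cons_le (s r : List (ι × ℝ≥0∞)) (a : ι × ℝ≥0∞)
    {g : (∀ i, X i) → ℝ≥0∞} (hg : Measurable g)
    (hs : ∀ b ∈ s, b.1 ≠ a.1 ∧ b.2 ≠ 0 ∧ b.2 ≤ a.2) :
    listNorm μ (s ++ a :: r) g ≤ listNorm μ (a :: (s ++ r)) g := by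
  induction s generalizing g with
  | nil => exact le_rfl
  | cons b s ih =>
    rw [List.forall_mem_cons] at hs
    calc listNorm μ (s ++ a :: r) (partialNorm μ b.1 b.2 g)
        ≤ listNorm μ (a :: (s ++ r)) (partialNorm μ b.1 b.2 g) :=
          ih (hg.partialNorm μ _ _) hs.2
      _ ≤ _ := listNorm_mono μ (s ++ r)
          (partialNorm_partialNorm_le μ hg hs.1.1.symm hs.1.2.1 hs.1.2.2)

/-- Among all orders of the variables, the one with decreasing exponents gives the largest mixed
norm. -/
theorem listNorm_le_of_perm_of_sorted {l l' : List (ι × ℝ≥0∞)} (hl : l.Perm l')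
    (hsort : l'.Pairwise fun a b => b.2 ≤ a.2) (hnodup : l'.Pairwise fun a b => b.1 ≠ a.1)
    (hpos : ∀ a ∈ l', a.2 ≠ 0) {g : (∀ i, X i) → ℝ≥0∞} (hg : Measurable g) :
    listNorm μ l g ≤ listNorm μ l' g := by
  induction l' generalizing l g with
  | nil => rw [hl.eq_nil]
  | cons a t ih =>
    obtain ⟨s, r, rfl⟩ := List.append_of_mem (hl.mem_iff.2 List.mem_cons_self)
    have hperm : (s ++ r).Perm t := (List.perm_middle.symm.trans hl).cons_inv
    rw [List.pairwise_cons] at hsort hnodup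
    rw [List.forall_mem_cons] at hpos
    refine (listNorm_append_cons_le μ s r a hg fun b hb => ?_).trans
      (ih hperm hsort.2 hnodup.2 hpos.2 (hg.partialNorm μ _ _))
    have hbt : b ∈ t := hperm.mem_iff.1 (List.mem_append_left _ hb)
    exact ⟨hnodup.1 b hbt, hpos.2 b hbt, hsort.1 b hbt⟩

/-- Hölder's inequality for mixed norms. -/
theorem listNorm_prod_rpow_le {κ : Type*} [Fintype κ] [Nonempty κ] (l : List ι)
    {q : κ → ι → ℝ≥0∞} {r : ι → ℝ≥0∞} (hq : ∀ k i, q k i ≠ 0)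
    (hr : ∀ i, ∑ k, (q k i)⁻¹ = Fintype.card κ * (r i)⁻¹) {g : κ → (∀ i, X i) → ℝ≥0∞}
    (hg : ∀ k, Measurable (g k)) (x : ∀ i, X i) :
    listNorm μ (l.map fun i => (i, r i))
        (fun x => ∏ k, g k x ^ (1 / (Fintype.card κ : ℝ))) x ≤
      ∏ k, listNorm μ (l.map fun i => (i, q k i)) (g k) x ^ (1 / (Fintype.card κ : ℝ)) := by
  induction l generalizing g with
  | nil => exact le_rfl
  | cons i l ih =>
    refine le_trans ?_ (ih fun k => (hg k).partialNorm μ i (q k i))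
    refine listNorm_mono μ _ (fun x => ?_) x
    exact eLpNorm_prod_rpow_le (fun k => hq k i) (hr i)
      fun k => (hg k).comp (measurable_update x)

/-- With equal exponents the outer power `1 / r` cancels against the next inner power `r`, leaving
Tonelli. The set `s` records the variables already integrated, as the induction requires. -/
theorem listNorm_const_exponent {g : (∀ i, X i) → ℝ≥0∞} (hg : Measurable g) {r : ℝ≥0∞}
    (hr : r ≠ 0) (hr' : r ≠ ∞) (l : List ι) (hl : l.Nodup) (s : Finset ι)
    (hs : ∀ i ∈ l, i ∉ s) :
    listNorm μ (l.map fun i => (i, r))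
        (fun x => (∫⋯∫⁻_s, (fun y => g y ^ r.toReal) ∂μ) x ^ (1 / r.toReal)) =
      fun x => (∫⋯∫⁻_(s ∪ l.toFinset), (fun y => g y ^ r.toReal) ∂μ) x ^ (1 / r.toReal) := by
  have hrr : 0 < r.toReal := ENNReal.toReal_pos hr hr'
  induction l generalizing s with
  | nil => simp
  | cons i l ih =>
    rw [List.nodup_cons] at hl
    rw [List.forall_mem_cons] at hs
    have hpart : partialNorm μ i r
        (fun x => (∫⋯∫⁻_s, (fun y => g y ^ r.toReal) ∂μ) x ^ (1 / r.toReal)) =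
        fun x => (∫⋯∫⁻_(insert i s), (fun y => g y ^ r.toReal) ∂μ) x ^ (1 / r.toReal) := by
      funext x
      rw [partialNorm, eLpNorm_ennreal_eq_lintegral hr hr',
        lmarginal_insert _ (hg.pow_const _) hs.1]
      simp_rw [← ENNReal.rpow_mul, one_div_mul_cancel hrr.ne', ENNReal.rpow_one]
    rw [List.map_cons, listNorm_cons, hpart, ih hl.2 (insert i s)]
    · simp [Finset.insert_union]
    · intro j hj
      rw [Finset.mem_insert, not_or]
      exact ⟨fun e => hl.1 (e ▸ hj), hs.2 j hj⟩

/-! ### Comparison with the norm on the product space -/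

section Pi

variable [Fintype ι]

theorem ae_le_partialNorm_top {g : (∀ i, X i) → ℝ≥0∞} (hg : Measurable g) (i : ι) :
    ∀ᵐ x ∂Measure.pi μ, g x ≤ partialNorm μ i ∞ g x := by
  rcases isEmpty_or_nonempty (∀ i, X i) with h | ⟨⟨x₀⟩⟩
  · exact .of_forall fun x => h.elim x
  set S : Set (∀ i, X i) := {x | partialNorm μ i ∞ g x < g x} with hS
  have hSm : MeasurableSet S := measurableSet_lt (hg.partialNorm μ i ∞) hg
  have hind : Measurable (S.indicator (1 : (∀ i, X i) → ℝ≥0∞)) := measurable_one.indicator hSm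
  -- The partial norm is constant along the `i`-th direction, so the exceptional set `S` has null
  -- sections there and is null by Tonelli.
  have h0 : ∫⋯∫⁻_{i}, S.indicator 1 ∂μ = ∫⋯∫⁻_{i}, 0 ∂μ := by
    funext x
    rw [lmarginal_singleton, lmarginal_singleton]
    refine lintegral_congr_ae ?_
    have : ∀ᵐ t ∂μ i, g (Function.update x i t) ≤ partialNorm μ i ∞ g x := by
      rw [partialNorm, eLpNorm_ennreal_top]
      exact ENNReal.ae_le_essSup _
    filter_upwards [this] with t ht
    refine Set.indicator_of_notMem ?_ _
    simpa [hS, partialNorm] using ht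
  have := lintegral_eq_of_lmarginal_eq {i} hind measurable_zero h0
  rw [lintegral_indicator_one hSm] at this
  rw [ae_iff]
  simpa [hS] using this

theorem ae_le_listNorm_top {g : (∀ i, X i) → ℝ≥0∞} (hg : Measurable g) (l : List ι) :
    ∀ᵐ x ∂Measure.pi μ, g x ≤ listNorm μ (l.map fun i => (i, ∞)) g x := by
  induction l generalizing g with
  | nil => exact .of_forall fun _ => le_rfl
  | cons i l ih =>
    filter_upwards [ae_le_partialNorm_top μ hg i, ih (hg.partialNorm μ i ∞)] with x h1 h2
    exact h1.trans h2

/-- The `L^r` norm on the product is at most the mixed norm with all exponents equal to `r`. -/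
theorem eLpNorm_pi_le_listNorm {g : (∀ i, X i) → ℝ≥0∞} (hg : Measurable g) (r : ℝ≥0∞)
    {l : List ι} (hl : l.Nodup) (hmem : ∀ i, i ∈ l) (x : ∀ i, X i) :
    eLpNorm g r (Measure.pi μ) ≤ listNorm μ (l.map fun i => (i, r)) g x := by
  rcases eq_or_ne r 0 with rfl | hr
  · simp
  rcases eq_or_ne r ∞ with rfl | hr'
  · rw [eLpNorm_ennreal_top]
    refine essSup_le_of_ae_le _ ((ae_le_listNorm_top μ hg l).mono fun y hy => hy.trans_eq ?_)
    refine listNorm_congr_of_eq_off μ _ g Set.univ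
      (fun x y h => congrArg g (funext fun i => h i trivial)) fun i _ hi => ?_
    exact absurd rfl (hi (i, ∞) (List.mem_map_of_mem (hmem i)))
  have hrr : 0 < r.toReal := ENNReal.toReal_pos hr hr'
  have := listNorm_const_exponent μ hg hr hr' l hl ∅ (by simp)
  simp only [lmarginal_empty, ← ENNReal.rpow_mul, mul_one_div_cancel hrr.ne', ENNReal.rpow_one,
    Finset.empty_union] at this
  have hu : l.toFinset = Finset.univ := by ext i; simp [hmem]
  rw [this, hu, lmarginal_univ, eLpNorm_ennreal_eq_lintegral hr hr']

end Pi

end MixedNorms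

/-! ### From iterated norms to norms along lists -/

/-- The iterated norm in the variables `e 0, …, e (k - 1)`, with the remaining variables frozen at
`x`, is a mixed norm along a list. -/
theorem iteratedNorm_eq_listNorm {ι : Type*} [DecidableEq ι] {X : ι → Type u}
    [∀ i, MeasurableSpace (X i)] (μ : ∀ i, Measure (X i)) {k : ℕ} (e : Fin k → ι)
    (he : Function.Injective e) (p : Fin k → ℝ≥0∞) (g : (∀ i, X i) → ℝ≥0∞) (x : ∀ i, X i)
    (F : (∀ j, X (e j)) → ∀ i, X i) (hF : ∀ y j, F y (e j) = y j)
    (hFx : ∀ y i, (∀ j, e j ≠ i) → F y i = x i) :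
    iteratedNorm (X := fun j => X (e j)) (fun j => μ (e j)) p (fun y => g (F y)) =
      listNorm μ (List.ofFn fun j => (e j, p j)) g x := by
  induction k generalizing x with
  | zero =>
    rw [iteratedNorm, List.ofFn_zero, listNorm_nil]
    exact congrArg g (funext fun i => hFx _ i fun j => j.elim0)
  | succ k ih =>
    rw [iteratedNorm, List.ofFn_succ_last, listNorm_append, listNorm_cons, listNorm_nil,
      partialNorm]
    refine congrArg (fun G => eLpNorm G _ _) (funext fun t => ?_)
    -- The outermost variable joins the frozen ones, with value `t`.
    refine ih (fun j => e j.castSucc) (fun i j h => Fin.castSucc_injective k (he h)) _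
      (Function.update x (e (Fin.last k)) t) (fun y => F (Fin.snoc y t)) (fun y j => ?_)
      fun y i hi => ?_
    · rw [hF, Fin.snoc_castSucc]
    · rcases eq_or_ne i (e (Fin.last k)) with rfl | hne
      · rw [hF, Fin.snoc_last, Function.update_self]
      · rw [Function.update_of_ne hne]
        refine hFx _ i fun j => ?_
        induction j using Fin.lastCases with
        | last => exact hne.symm
        | cast j => exact hi j

/-! ### Double tuples and the symmetry of the orbit -/

namespace DoubleTuple

variable {n : ℕ}

theorem mixedNorm_eq_listNorm {X : Fin n → Type u} [∀ i, MeasurableSpace (X i)]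
    (μ : ∀ i, Measure (X i)) (P : DoubleTuple n) (f : (∀ i, X i) → ℝ≥0∞) (x : ∀ i, X i) :
    P.mixedNorm μ f = listNorm μ (List.ofFn fun j => (P.vars j, P.exps j)) f x :=
  iteratedNorm_eq_listNorm μ P.vars P.vars.injective P.exps f x _
    (fun y j => Equiv.piCongrLeft_apply_apply X P.vars y j)
    fun _ i hi => absurd (P.vars.apply_symm_apply i) (hi _)

/-- Ordering the columns by decreasing exponents increases the mixed norm. -/
theorem listNorm_le_mixedNorm {X : Fin n → Type u} [∀ i, MeasurableSpace (X i)]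
    (μ : ∀ i, Measure (X i)) [∀ i, SigmaFinite (μ i)] (P : DoubleTuple n)
    (hpos : ∀ j, P.exps j ≠ 0) (hanti : Antitone P.exps) {f : (∀ i, X i) → ℝ≥0∞}
    (hf : Measurable f) (x : ∀ i, X i) :
    listNorm μ ((List.finRange n).map fun i => (i, P.exps (P.vars.symm i))) f x ≤
      P.mixedNorm μ f := by
  rw [mixedNorm_eq_listNorm μ P f x]
  refine listNorm_le_of_perm_of_sorted μ ?_ ?_ ?_ ?_ hf x
  · have := ((Equiv.Perm.map_finRange_perm P.vars).symm.map
      fun i => (i, P.exps (P.vars.symm i)))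
    simpa [List.ofFn_eq_map, Function.comp_def] using this
  · rw [List.pairwise_ofFn]
    exact fun i j hij => hanti hij.le
  · rw [List.pairwise_ofFn]
    exact fun i j hij h => hij.ne' (P.vars.injective h)
  · rw [List.forall_mem_ofFn_iff]
    exact hpos

theorem Identified.exists_perm {P Q : DoubleTuple n} (h : Identified P Q) :
    ∃ ρ : Equiv.Perm (Fin n), Q.vars = P.vars * ρ ∧ ∀ j, P.exps (ρ j) = P.exps j := by
  obtain ⟨-, ρ, hρ, hb⟩ := h
  exact ⟨ρ, hρ, fun j => hb j _ Set.right_mem_uIcc⟩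

/-- A monotone sequence that takes the same value at two positions is constant between them, so
preserving exponents already means staying within blocks. -/
theorem identified_of_exps_comp_eq {P Q : DoubleTuple n} (hanti : Antitone P.exps)
    (hexps : Q.exps = P.exps) (ρ : Equiv.Perm (Fin n)) (hvars : Q.vars = P.vars * ρ)
    (hρ : ∀ j, P.exps (ρ j) = P.exps j) : Identified P Q := by
  refine ⟨hexps, ρ, hvars, fun j k hk => ?_⟩
  rcases Set.mem_uIcc.1 hk with ⟨h1, h2⟩ | ⟨h1, h2⟩
  · exact le_antisymm (hanti h1) ((hρ j).symm.le.trans (hanti h2))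
  · exact le_antisymm ((hanti h1).trans (hρ j).le) (hanti h2)

namespace EnumeratesOrbit

variable {p : Fin n → ℝ≥0∞} {m : ℕ} {P : Fin m → DoubleTuple n}

theorem exps_eq (hP : (ofExponents p).EnumeratesOrbit P) (i : Fin m) : (P i).exps = p := by
  obtain ⟨σ, hσ⟩ := hP.mem_orbit i
  rw [hσ]; rfl

/-- In an enumeration of the orbit, the exponents that are attached to a variable do not depend on
this variable, up to the order. -/
theorem sum_comp_symm_eq (hP : (ofExponents p).EnumeratesOrbit P) (hanti : Antitone p)
    (g : ℝ≥0∞ → ℝ≥0∞) (i j : Fin n) :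
    ∑ k, g (p ((P k).vars.symm i)) = ∑ k, g (p ((P k).vars.symm j)) := by
  -- Relabelling the variables by `τ` sends the class of `P k` to that of `P (φ k)`; the correction
  -- `ρ k` only permutes positions with equal exponents.
  set τ : Equiv.Perm (Fin n) := Equiv.swap i j
  have hex : ∀ k, ∃ k', ∃ ρ : Equiv.Perm (Fin n), (P k').vars = τ * (P k).vars * ρ ∧
      ∀ j, p (ρ j) = p j := by
    intro k
    obtain ⟨k', hk'⟩ := hP.surjective (τ * (P k).vars)
    obtain ⟨ρ, h1, h2⟩ := hk'.exists_perm
    exact ⟨k', ρ, by simpa [permVars, ofExponents] using h1, h2⟩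
  choose φ ρ hφ hρ using hex
  have hρ' : ∀ k j, p ((ρ k).symm j) = p j := fun k j => by
    rw [← hρ k, Equiv.apply_symm_apply]
  have hinj : Function.Injective φ := by
    intro k l hkl
    refine hP.injective k l ?_
    refine identified_of_exps_comp_eq (by rwa [hP.exps_eq]) (by rw [hP.exps_eq, hP.exps_eq])
      (ρ k * (ρ l)⁻¹) ?_ fun j => ?_
    · have h : τ * (P k).vars * ρ k = τ * (P l).vars * ρ l := by rw [← hφ, ← hφ, hkl]
      rw [mul_assoc, mul_assoc, mul_right_inj] at h
      rw [← mul_assoc, h, mul_inv_cancel_right]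
    · rw [hP.exps_eq]
      exact (hρ k _).trans (hρ' l j)
  -- An injective self-map of a finite set is a bijection, so `φ` may reindex the sum; the exponent
  -- of `i` in `P (φ k)` is that of `j` in `P k`.
  rw [← (Finite.injective_iff_bijective.1 hinj).sum_comp fun k => g (p ((P k).vars.symm i))]
  refine Finset.sum_congr rfl fun k _ => congrArg g ?_
  have h : (P (φ k)).vars.symm i = (ρ k).symm ((P k).vars.symm j) := by
    rw [Equiv.symm_apply_eq, hφ]
    simp [τ]
  rw [h, hρ']

/-- This is the exponent condition for Hölder. Summed over all variables, each `P k` contributes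
every `(p j)⁻¹` once, and the `n` sums are equal. -/
theorem sum_inv_comp_symm (hP : (ofExponents p).EnumeratesOrbit P) (hanti : Antitone p)
    (hn : 0 < n) (i : Fin n) :
    ∑ k, (p ((P k).vars.symm i))⁻¹ = m * (harmonicMeanExponent p)⁻¹ := by
  have h1 : (n : ℝ≥0∞) * ∑ k, (p ((P k).vars.symm i))⁻¹ = m * ∑ j, (p j)⁻¹ := by
    calc (n : ℝ≥0∞) * ∑ k, (p ((P k).vars.symm i))⁻¹
        = ∑ j, ∑ k, (p ((P k).vars.symm j))⁻¹ := by
          rw [Finset.sum_congr rfl fun j _ => hP.sum_comp_symm_eq hanti (·⁻¹) j i]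
          simp
      _ = ∑ k : Fin m, ∑ j, (p j)⁻¹ := by
          rw [Finset.sum_comm]
          exact Finset.sum_congr rfl fun k _ =>
            Equiv.sum_comp (P k).vars.symm fun j => (p j)⁻¹
      _ = m * ∑ j, (p j)⁻¹ := by simp
  have hn0 : (n : ℝ≥0∞) ≠ 0 := by exact_mod_cast hn.ne'
  rw [harmonicMeanExponent, inv_inv, mul_left_comm, ← h1, ← mul_assoc,
    ENNReal.inv_mul_cancel hn0 (by simp), one_mul]

end EnumeratesOrbit

end DoubleTuple

/-! ### The main inequality -/

theorem corollary3p6 {n : ℕ} (hn : 0 < n) {X : Fin n → Type u}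
    [(i : Fin n) → MeasurableSpace (X i)] (μ : (i : Fin n) → Measure (X i))
    [∀ i, SigmaFinite (μ i)]
    (p : Fin n → ℝ≥0∞) (hp_pos : ∀ j, 0 < p j) (hp_anti : Antitone p)
    {m : ℕ} (P : Fin m → DoubleTuple n)
    (hP : (DoubleTuple.ofExponents p).EnumeratesOrbit P)
    (f : ((i : Fin n) → X i) → ℝ≥0∞) (hf : Measurable f) :
    eLpNorm f (harmonicMeanExponent p) (Measure.pi μ) ≤
      ∏ i : Fin m, (P i).mixedNorm μ f ^ (1 / (m : ℝ)) := by
  -- `listNorm` has to be evaluated at a base point; on an empty product the left side vanishes.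
  rcases isEmpty_or_nonempty (∀ i, X i) with h | ⟨⟨x⟩⟩
  · rw [Measure.eq_zero_of_isEmpty (Measure.pi μ), eLpNorm_measure_zero]
    exact zero_le
  have : Nonempty (Fin m) := ⟨(hP.surjective 1).choose⟩
  have hm : (m : ℝ) ≠ 0 := by exact_mod_cast (Fin.pos_iff_nonempty.2 this).ne'
  set r := harmonicMeanExponent p
  have hf_prod : f = fun x => ∏ _k : Fin m, f x ^ (1 / (Fintype.card (Fin m) : ℝ)) := by
    funext x
    rw [Finset.prod_const, Finset.card_univ, Fintype.card_fin, ← ENNReal.rpow_natCast,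
      ← ENNReal.rpow_mul, one_div_mul_cancel hm, ENNReal.rpow_one]
  calc eLpNorm f r (Measure.pi μ)
      ≤ listNorm μ ((List.finRange n).map fun i => (i, r)) f x :=
        eLpNorm_pi_le_listNorm μ hf r (List.nodup_finRange n) List.mem_finRange x
    _ = listNorm μ ((List.finRange n).map fun i => (i, r))
          (fun x => ∏ _k : Fin m, f x ^ (1 / (Fintype.card (Fin m) : ℝ))) x := by
        rw [← hf_prod]
    _ ≤ ∏ k, listNorm μ ((List.finRange n).map fun i => (i, p ((P k).vars.symm i))) f x ^
          (1 / (Fintype.card (Fin m) : ℝ)) := by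
        refine listNorm_prod_rpow_le μ (List.finRange n) (r := fun _ => r)
          (fun k i => (hp_pos _).ne') (fun i => ?_) (fun _ => hf) x
        rw [Fintype.card_fin]
        exact hP.sum_inv_comp_symm hp_anti hn i
    _ ≤ ∏ k, (P k).mixedNorm μ f ^ (1 / (m : ℝ)) := by
        rw [Fintype.card_fin]
        refine Finset.prod_le_prod' fun k _ => ENNReal.rpow_le_rpow ?_ (by positivity)
        rw [← hP.exps_eq k]
        exact (P k).listNorm_le_mixedNorm μ (fun j => by rw [hP.exps_eq]; exact (hp_pos j).ne')
          (by rwa [hP.exps_eq]) hf x
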